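/- Let $m,n\ge 0$, let $\phi$ be a smooth linear action of the Lie group $\mathbb{R}^m$ on $\mathbb{R}^n$ which is semi-simple (every invariant subspace has an invariant complement), and let $G=\mathbb{R}^m\ltimes_\phi\mathbb{R}^n$, with Lie algebra $\mathfrak g$. Suppose that $\dim[G,G]>\frac{\dim G}{2}$, that $\Gamma\subset G$ is a lattice (a discrete cocompact subgroup), and that $b_1(G/\Gamma)=b_1(\mathfrak g)$. Here $G/\Gamma$ denotes the compact quotient manifold of $G$ by the left translations by elements of $\Gamma$ (so that left-invariant tensors on $G$ descend to it), $b_1(G/\Gamma)=\dim H^1_{dR}(G/\Gamma)$, and $b_1(\mathfrak g)=\dim H^1(\mathfrak g)=\dim\{\lambda\in\mathfrak g^*:\lambda([X,Y])=0\ \text{for all } X,Y\in\mathfrak g\}$. Let $\omega$ be a locally conformal symplectic form on $G/\Gamma$ with Lee form $\theta$, not necessarily left-invariant; that is, $\omega$ is a smooth non-degenerate $2$-form and $\theta$ is a smooth closed $1$-form with $d\omega=\theta\wedge\omega$. Suppose that there is a left-invariant almost complex structure $J$ on $G/\Gamma$ (one induced by a linear map $J_0:\mathfrak g\to\mathfrak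 g$ with $J_0^2=-1$) that is compatible with $\omega$: $\omega(Ju,Jv)=\omega(u,v)$ for all tangent vectors $u,v$ at the same point, and $\omega(v,Jv)>0$ for every tangent vector $v\ne 0$. Then the class $[\omega]_\theta$ is not zero in $H^2_\theta(G/\Gamma)$, the second cohomology of the de Rham complex of $G/\Gamma$ with the twisted differential $d_\theta\alpha=d\alpha-\theta\wedge\alpha$. -/

import Mathlib

open scoped Manifold ContDiff

/-! ## Differential forms and twisted cohomology on a manifold modelled on `E` -/

section Forms

/-- (Not necessarily smooth) differential `k`-forms on a manifold `M` modelled on `E`. -/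
def DForm (E : Type) [NormedAddCommGroup E] [NormedSpace ℝ E]
    (M : Type) [TopologicalSpace M] [ChartedSpace E M] (k : ℕ) : Type :=
  (x : M) → TangentSpace 𝓘(ℝ, E) x [⋀^Fin k]→L[ℝ] ℝ

namespace DForm

variable {E : Type} [NormedAddCommGroup E] [NormedSpace ℝ E]
  {M : Type} [TopologicalSpace M] [ChartedSpace E M] {k : ℕ}

noncomputable instance : AddCommGroup (DForm E M k) :=
  inferInstanceAs (AddCommGroup ((x : M) → TangentSpace 𝓘(ℝ, E) x [⋀^Fin k]→L[ℝ] ℝ))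

noncomputable instance : Module ℝ (DForm E M k) :=
  inferInstanceAs (Module ℝ ((x : M) → TangentSpace 𝓘(ℝ, E) x [⋀^Fin k]→L[ℝ] ℝ))

/-- The expression of a differential form in the preferred chart at `x₀`: the pullback of the form
under the inverse of the chart. -/
noncomputable def inChart (x₀ : M) (α : DForm E M k) (y : E) : E [⋀^Fin k]→L[ℝ] ℝ :=
  (α ((extChartAt 𝓘(ℝ, E) x₀).symm y)).compContinuousLinearMap
    (mfderiv 𝓘(ℝ, E) 𝓘(ℝ, E) (extChartAt 𝓘(ℝ, E) x₀).symm y : E →L[ℝ] _)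

/-- A differential form is smooth if its expression in each chart is smooth. -/
def IsSmooth (α : DForm E M k) : Prop :=
  ∀ x₀ : M, ContDiffOn ℝ ∞ (inChart x₀ α) (extChartAt 𝓘(ℝ, E) x₀).target

/-- The exterior derivative, computed at `x` in the preferred chart at `x`. -/
noncomputable def d (α : DForm E M k) : DForm E M (k + 1) := fun x =>
  (extDeriv (inChart x α) (extChartAt 𝓘(ℝ, E) x x)).compContinuousLinearMap
    (mfderiv 𝓘(ℝ, E) 𝓘(ℝ, E) (extChartAt 𝓘(ℝ, E) x) x : _ →L[ℝ] E)

/-- The wedge product of a `1`-form and a `k`-form on a vector space,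
`(a ∧ b)(v₀, …, v_k) = ∑ i, (-1)^i a(v_i) b(v₀, …, v_{i-1}, v_{i+1}, …, v_k)`. -/
noncomputable def wedgeVec (a : E [⋀^Fin 1]→L[ℝ] ℝ) (b : E [⋀^Fin k]→L[ℝ] ℝ) :
    E [⋀^Fin (k + 1)]→L[ℝ] ℝ :=
  ContinuousAlternatingMap.alternatizeUncurryFin
    (((ContinuousAlternatingMap.ofSubsingleton ℝ E ℝ (0 : Fin 1)).symm a).smulRight b)

/-- The wedge product of a `1`-form and a `k`-form. -/
noncomputable def wedge (θ : DForm E M 1) (α : DForm E M k) : DForm E M (k + 1) :=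
  fun x => wedgeVec (E := E) (θ x) (α x)

/-- The twisted differential `d_θ α = dα - θ ∧ α`. -/
noncomputable def twistedD (θ : DForm E M 1) (α : DForm E M k) : DForm E M (k + 1) :=
  d α - wedge θ α

theorem inChart_add (x₀ : M) (α η : DForm E M k) :
    inChart x₀ (α + η) = inChart x₀ α + inChart x₀ η := by
  ext y v; rfl

theorem inChart_smul (x₀ : M) (c : ℝ) (α : DForm E M k) :
    inChart x₀ (c • α) = c • inChart x₀ α := by
  ext y v; rfl

theorem inChart_zero (x₀ : M) : inChart x₀ (0 : DForm E M k) = 0 := by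
  ext y v; rfl

theorem isSmooth_zero : IsSmooth (0 : DForm E M k) := fun x₀ => by
  rw [inChart_zero]; exact contDiffOn_const

theorem IsSmooth.add {α η : DForm E M k} (hα : IsSmooth α) (hη : IsSmooth η) :
    IsSmooth (α + η) := fun x₀ => by
  rw [inChart_add]; exact (hα x₀).add (hη x₀)

theorem IsSmooth.smul {α : DForm E M k} (c : ℝ) (hα : IsSmooth α) :
    IsSmooth (c • α) := fun x₀ => by
  rw [inChart_smul]; exact (hα x₀).const_smul c

theorem IsSmooth.differentiableAt {α : DForm E M k} (hα : IsSmooth α) (x : M) :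
    DifferentiableAt ℝ (inChart x α) (extChartAt 𝓘(ℝ, E) x x) :=
  ((hα x).contDiffAt (extChartAt_target_mem_nhds x)).differentiableAt (by simp)

theorem d_add {α η : DForm E M k} (hα : IsSmooth α) (hη : IsSmooth η) :
    d (α + η) = d α + d η := by
  funext x
  change (extDeriv (inChart x (α + η)) _).compContinuousLinearMap _ = _
  rw [inChart_add, extDeriv_add (hα.differentiableAt x) (hη.differentiableAt x)]
  rfl

theorem d_smul (c : ℝ) (α : DForm E M k) : d (c • α) = c • d α := by
  funext x
  change (extDeriv (inChart x (c • α)) _).compContinuousLinearMap _ = _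
  rw [inChart_smul, extDeriv_smul]
  rfl

theorem wedgeVec_add (a : E [⋀^Fin 1]→L[ℝ] ℝ) (b c : E [⋀^Fin k]→L[ℝ] ℝ) :
    wedgeVec a (b + c) = wedgeVec a b + wedgeVec a c := by
  ext v
  simp [wedgeVec, ContinuousAlternatingMap.alternatizeUncurryFin_apply,
    Finset.sum_add_distrib]

theorem wedgeVec_smul (a : E [⋀^Fin 1]→L[ℝ] ℝ) (r : ℝ) (b : E [⋀^Fin k]→L[ℝ] ℝ) :
    wedgeVec a (r • b) = r • wedgeVec a b := by
  ext v
  simp only [wedgeVec, ContinuousAlternatingMap.alternatizeUncurryFin_apply,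
    ContinuousAlternatingMap.smul_apply, ContinuousLinearMap.smulRight_apply, Finset.smul_sum]
  refine Finset.sum_congr rfl fun i _ => ?_
  simp only [smul_eq_mul, zsmul_eq_mul]
  ring

theorem wedge_add (θ : DForm E M 1) (α η : DForm E M k) :
    wedge θ (α + η) = wedge θ α + wedge θ η :=
  funext fun x => wedgeVec_add (E := E) (θ x) (α x) (η x)

theorem wedge_smul (θ : DForm E M 1) (c : ℝ) (α : DForm E M k) :
    wedge θ (c • α) = c • wedge θ α :=
  funext fun x => wedgeVec_smul (E := E) (θ x) c (α x)

theorem twistedD_add (θ : DForm E M 1) {α η : DForm E M k} (hα : IsSmooth α) (hη : IsSmooth η) :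
    twistedD θ (α + η) = twistedD θ α + twistedD θ η := by
  simp only [twistedD, d_add hα hη, wedge_add]; abel

theorem twistedD_smul (θ : DForm E M 1) (c : ℝ) (α : DForm E M k) :
    twistedD θ (c • α) = c • twistedD θ α := by
  simp only [twistedD, d_smul, wedge_smul, smul_sub]

theorem twistedD_zero (θ : DForm E M 1) : twistedD θ (0 : DForm E M k) = 0 := by
  simpa using twistedD_smul θ 0 (0 : DForm E M k)

/-- The smooth `d_θ`-closed `k`-forms. -/
noncomputable def closedForms (θ : DForm E M 1) (k : ℕ) : Submodule ℝ (DForm E M k) where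
  carrier := {α | IsSmooth α ∧ twistedD θ α = 0}
  add_mem' ha hb := ⟨ha.1.add hb.1, by rw [twistedD_add θ ha.1 hb.1, ha.2, hb.2, add_zero]⟩
  zero_mem' := ⟨isSmooth_zero, twistedD_zero θ⟩
  smul_mem' c _ ha := ⟨ha.1.smul c, by rw [twistedD_smul, ha.2, smul_zero]⟩

/-- The `d_θ`-exact `(k + 1)`-forms, i.e. the `d_θ η` with `η` a smooth `k`-form. -/
noncomputable def exactForms (θ : DForm E M 1) (k : ℕ) : Submodule ℝ (DForm E M (k + 1)) where
  carrier := {α | ∃ η : DForm E M k, IsSmooth η ∧ twistedD θ η = α}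
  add_mem' := by
    rintro _ _ ⟨a, ha, rfl⟩ ⟨b, hb, rfl⟩
    exact ⟨a + b, ha.add hb, twistedD_add θ ha hb⟩
  zero_mem' := ⟨0, isSmooth_zero, twistedD_zero θ⟩
  smul_mem' := by
    rintro c _ ⟨a, ha, rfl⟩
    exact ⟨c • a, ha.smul c, twistedD_smul θ c a⟩

/-- The twisted cohomology `H^{k+1}_θ(M)`, for a closed `1`-form `θ`:
`d_θ`-closed smooth `(k + 1)`-forms modulo `d_θ`-exact ones. -/
abbrev TwistedCohomology (θ : DForm E M 1) (k : ℕ) : Type :=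
  closedForms θ (k + 1) ⧸ (exactForms θ k).submoduleOf (closedForms θ (k + 1))

/-- The class `[α]_θ ∈ H^{k+1}_θ(M)` of a `d_θ`-closed smooth form. -/
noncomputable def twistedClass (θ : DForm E M 1) (α : DForm E M (k + 1))
    (hα : α ∈ closedForms θ (k + 1)) : TwistedCohomology θ k :=
  Submodule.Quotient.mk ⟨α, hα⟩

variable (E M) in
/-- The first Betti number: the dimension of the first de Rham cohomology, which is the twisted
cohomology for `θ = 0`. -/
noncomputable def bettiOne : Cardinal :=
  Module.rank ℝ (TwistedCohomology (0 : DForm E M 1) 0)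

/-- `α` is a locally conformal symplectic form with Lee form `θ`: a smooth non-degenerate
`2`-form with `dα = θ ∧ α`, where `θ` is a smooth closed `1`-form. -/
structure IsLCS (α : DForm E M 2) (θ : DForm E M 1) : Prop where
  smooth : IsSmooth α
  nondegenerate : ∀ (x : M) (u : TangentSpace 𝓘(ℝ, E) x),
    (∀ v : TangentSpace 𝓘(ℝ, E) x, α x ![u, v] = 0) → u = 0
  lee_smooth : IsSmooth θ
  lee_closed : d θ = 0
  d_eq : d α = wedge θ α

theorem IsLCS.mem_closedForms {α : DForm E M 2} {θ : DForm E M 1} (h : IsLCS α θ) :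
    α ∈ closedForms θ 2 :=
  ⟨h.smooth, by rw [twistedD, h.d_eq, sub_self]⟩

/-- An almost complex structure `J` is compatible with the `2`-form `α` if `α` is `J`-invariant and
`α(v, J v) > 0` for `v ≠ 0`. -/
def IsCompatible (α : DForm E M 2)
    (J : (x : M) → TangentSpace 𝓘(ℝ, E) x →L[ℝ] TangentSpace 𝓘(ℝ, E) x) : Prop :=
  ∀ (x : M) (v : TangentSpace 𝓘(ℝ, E) x),
    (∀ w : TangentSpace 𝓘(ℝ, E) x, α x ![J x v, J x w] = α x ![v, w]) ∧
      (v ≠ 0 → 0 < α x ![v, J x v])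

end DForm

end Forms

/-! ## Lie algebras of Lie groups -/

section LieGroups

/-- The first Betti number of a real Lie algebra `L`: the dimension of
`H¹(L) = {l ∈ L* | l([X, Y]) = 0 for all X, Y}`. -/
noncomputable def lieBettiOne (L : Type) [LieRing L] [LieAlgebra ℝ L] : Cardinal :=
  Module.rank ℝ
    (⨅ p : L × L, LinearMap.ker (Module.Dual.eval ℝ L ⁅p.1, p.2⁆) : Submodule ℝ (Module.Dual ℝ L))

variable {E : Type} [NormedAddCommGroup E] [NormedSpace ℝ E]
  {G : Type} [TopologicalSpace G] [ChartedSpace E G] [Group G]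

/-- The Lie algebra of a subgroup `H` of a Lie group `G`: the (span of the) vectors `X` in the Lie
algebra of `G` whose one-parameter subgroup `t ↦ exp (t X)`, the integral curve through `1` of the
left-invariant vector field of `X`, stays in `H`. -/
noncomputable def subgroupLieAlgebra (H : Subgroup G) : Submodule ℝ (GroupLieAlgebra 𝓘(ℝ, E) G) :=
  Submodule.span ℝ {X | ∃ c : ℝ → G,
    IsMIntegralCurve (I := 𝓘(ℝ, E)) c (mulInvariantVectorField (I := 𝓘(ℝ, E)) X) ∧
      c 0 = 1 ∧ ∀ t, c t ∈ H}

end LieGroups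

/-! ## The groups `ℝ^m ⋉_φ ℝ^n` -/

section MetaAbelian

/-- The vector space `ℝ^m × ℝ^n` on which `ℝ^m ⋉_φ ℝ^n` is modelled. -/
abbrev Coord (m n : ℕ) : Type := (Fin m → ℝ) × (Fin n → ℝ)

/-- A (smooth, linear) action of the Lie group `ℝ^m` on `ℝ^n`. -/
structure VectorAction (m n : ℕ) where
  rep : Representation ℝ (Multiplicative (Fin m → ℝ)) (Fin n → ℝ)
  smooth : ContDiff ℝ ∞ fun p : Coord m n => rep (Multiplicative.ofAdd p.1) p.2

variable {m n : ℕ}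

/-- The manifold underlying the semi-direct product `ℝ^m ⋉_φ ℝ^n`. -/
def MetaAbelianGroup (_φ : VectorAction m n) : Type := Coord m n

namespace MetaAbelianGroup

variable (φ : VectorAction m n)

instance : TopologicalSpace (MetaAbelianGroup φ) :=
  inferInstanceAs (TopologicalSpace (Coord m n))

instance : T2Space (MetaAbelianGroup φ) :=
  inferInstanceAs (T2Space (Coord m n))

instance : LocallyCompactSpace (MetaAbelianGroup φ) :=
  inferInstanceAs (LocallyCompactSpace (Coord m n))

instance : ChartedSpace (Coord m n) (MetaAbelianGroup φ) :=
  inferInstanceAs (ChartedSpace (Coord m n) (Coord m n))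

/-- The group structure of the semi-direct product: `(a, x) (b, y) = (a + b, x + φ(a) y)`. -/
instance : Group (MetaAbelianGroup φ) where
  mul p q := (p.1 + q.1, p.2 + φ.rep (Multiplicative.ofAdd p.1) q.2)
  one := (0, 0)
  inv p := (-p.1, -φ.rep (Multiplicative.ofAdd (-p.1)) p.2)
  mul_assoc p q r := Prod.ext (add_assoc p.1 q.1 r.1) <| by
    change (p.2 + φ.rep (Multiplicative.ofAdd p.1) q.2) +
      φ.rep (Multiplicative.ofAdd (p.1 + q.1)) r.2 =
      p.2 + φ.rep (Multiplicative.ofAdd p.1) (q.2 + φ.rep (Multiplicative.ofAdd q.1) r.2)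
    rw [ofAdd_add, map_mul, Module.End.mul_apply, map_add, add_assoc]
  one_mul p := Prod.ext (zero_add p.1) <| by
    change 0 + φ.rep (Multiplicative.ofAdd 0) p.2 = p.2
    simp
  mul_one p := Prod.ext (add_zero p.1) <| by
    change p.2 + φ.rep (Multiplicative.ofAdd p.1) 0 = p.2
    simp
  inv_mul_cancel p := Prod.ext (neg_add_cancel p.1) <| by
    change -φ.rep (Multiplicative.ofAdd (-p.1)) p.2 + φ.rep (Multiplicative.ofAdd (-p.1)) p.2 = 0
    simp

instance : LieGroup 𝓘(ℝ, Coord m n) ∞ (MetaAbelianGroup φ) where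
  toIsManifold := inferInstanceAs (IsManifold 𝓘(ℝ, Coord m n) ∞
    (Coord m n))
  contMDiff_mul := by
    have h : ContDiff ℝ ∞ fun p : Coord m n × Coord m n =>
        (p.1.1 + p.2.1, p.1.2 + φ.rep (Multiplicative.ofAdd p.1.1) p.2.2) :=
      (by fun_prop : ContDiff ℝ ∞ fun p : Coord m n × Coord m n => p.1.1 + p.2.1).prodMk
        ((by fun_prop : ContDiff ℝ ∞ fun p : Coord m n × Coord m n => p.1.2).add
        (φ.smooth.comp (by fun_prop : ContDiff ℝ ∞ fun p : Coord m n × Coord m n => (p.1.1, p.2.2))))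
    have h' := h.contMDiff
    rw [modelWithCornersSelf_prod, ← chartedSpaceSelf_prod] at h'
    exact h'
  contMDiff_inv := by
    have h : ContDiff ℝ ∞ fun p : Coord m n =>
        (-p.1, -φ.rep (Multiplicative.ofAdd (-p.1)) p.2) :=
      (by fun_prop : ContDiff ℝ ∞ fun p : Coord m n => -p.1).prodMk
        (φ.smooth.comp (by fun_prop : ContDiff ℝ ∞ fun p : Coord m n =>
          (-p.1, p.2))).neg
    exact h.contMDiff

instance : LieGroup 𝓘(ℝ, Coord m n) (minSmoothness ℝ 3) (MetaAbelianGroup φ) :=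
  LieGroup.of_le (n := ∞) (by simpa using WithTop.coe_le_coe.2 (le_top : (3 : ℕ∞) ≤ ⊤))

instance : IsTopologicalGroup (MetaAbelianGroup φ) :=
  topologicalGroup_of_lieGroup 𝓘(ℝ, Coord m n) ∞

variable {φ} (Γ : Subgroup (MetaAbelianGroup φ))

/-- A discrete subgroup acts properly discontinuously by left translations. -/
instance [DiscreteTopology Γ] : ProperlyDiscontinuousSMul Γ (MetaAbelianGroup φ) :=
  Γ.properlyDiscontinuousSMul_of_tendsto_cofinite (Γ.tendsto_coe_cofinite_of_discrete ⟨inferInstance⟩)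

/-- The quotient of `G = ℝ^m ⋉_φ ℝ^n` by the left translations of `Γ`. -/
abbrev LatticeQuotient : Type := MulAction.orbitRel.Quotient Γ (MetaAbelianGroup φ)

/-- The projection of `G` to its quotient by `Γ`. -/
def proj : MetaAbelianGroup φ → LatticeQuotient Γ := Quotient.mk _

/-- `J` is a left-invariant almost complex structure on the quotient of `G` by `Γ`: it is induced
by a left-invariant almost complex structure on `G`, i.e. by a complex structure `J₀` on the Lie
algebra of `G`. -/
def IsLeftInvariantAlmostComplex [DiscreteTopology Γ]
    (J : (x : LatticeQuotient Γ) → TangentSpace 𝓘(ℝ, Coord m n) x →L[ℝ]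
      TangentSpace 𝓘(ℝ, Coord m n) x) : Prop :=
  ∃ J₀ : GroupLieAlgebra 𝓘(ℝ, Coord m n) (MetaAbelianGroup φ) →ₗ[ℝ]
      GroupLieAlgebra 𝓘(ℝ, Coord m n) (MetaAbelianGroup φ),
    (∀ X, J₀ (J₀ X) = -X) ∧
      ∀ g X,
        J (proj Γ g) (mfderiv 𝓘(ℝ, Coord m n) 𝓘(ℝ, Coord m n)
          (proj Γ) g (mulInvariantVectorField X g)) =
        mfderiv 𝓘(ℝ, Coord m n) 𝓘(ℝ, Coord m n)
          (proj Γ) g (mulInvariantVectorField (J₀ X) g)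

end MetaAbelianGroup

end MetaAbelian

/-!
The argument takes place on the universal cover `G = ℝ^m × ℝ^n`, with the deck transformations
acting by affine maps (`IsAffineCovering`), so that forms on `G/Γ` become forms on a vector space
and the exterior derivative becomes the ordinary one (`IsAffineCovering.lift_d`).

Suppose that `α = dη - θ ∧ η`. A linear form `l` on the Lie algebra which vanishes on all brackets
is invariant under the action, hence is a constant closed form on `G` which descends to `G/Γ`. It is
not exact there unless it vanishes, because a function on a compact manifold has a critical point.
So `H¹(𝔤)` embeds in `H¹(G/Γ)`, and equality of the Betti numbers gives `θ = l + df` for such an `l`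
(`MetaAbelianGroup.exists_eq_constForm_add_d`).

In coordinates, the projection to `ℝ^m` and such an `l` are homomorphisms on `G`, so both vanish on
the Lie algebra `S` of `[G, G]`. As `S` has more than half the dimension, there is `v ≠ 0` in `S`
with `w = Jv` in `S`. Since `v` and `w` lie in the abelian ideal `ℝ^n` and `θ` agrees with `df` on
both of them,
`e⁻ᶠ α(v, w) = ∂_v (e⁻ᶠ η(w)) - ∂_w (e⁻ᶠ η(v))`
on the plane through the identity spanned by `v` and `w` (`DForm.exp_mul_extDeriv_sub_wedge`). On
this plane `v` and `w` are left-invariant fields, so by compactness of `G/Γ` the left-hand side is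
bounded below by a positive constant, while `e⁻ᶠ η(v)` and `e⁻ᶠ η(w)` are bounded. Integration over
a large square shows that this is impossible (`not_forall_le_divergence`). Working on this plane
replaces the averaging of forms over `G/Γ`.
-/

/-! ### Forms of low degree -/

namespace DForm

variable {E M : Type} [NormedAddCommGroup E] [NormedSpace ℝ E]
  [TopologicalSpace M] [ChartedSpace E M] {k : ℕ}

open scoped Topology

theorem wedgeVec_apply (a : E [⋀^Fin 1]→L[ℝ] ℝ) (b : E [⋀^Fin k]→L[ℝ] ℝ)
    (v : Fin (k + 1) → E) :
    wedgeVec a b v = ∑ i : Fin (k + 1), (-1) ^ i.val • (a ![v i] * b (i.removeNth v)) := by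
  simp only [wedgeVec, ContinuousAlternatingMap.alternatizeUncurryFin_apply]
  refine Finset.sum_congr rfl fun i _ => ?_
  congr 1
  change a (Function.const _ (v i)) * _ = _
  congr 2
  funext j
  simp

theorem extDeriv_zero_form_apply {β : E → E [⋀^Fin 0]→L[ℝ] ℝ} {y : E}
    (h : DifferentiableAt ℝ β y) (v : E) :
    extDeriv β y ![v] = fderiv ℝ (fun u => β u ![]) y v := by
  rw [extDeriv_apply h]
  have h0 : (0 : Fin 1).removeNth ![v] = (![] : Fin 0 → E) := Subsingleton.elim _ _
  simp [h0]

theorem extDeriv_one_form_apply {β : E → E [⋀^Fin 1]→L[ℝ] ℝ} {y : E}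
    (h : DifferentiableAt ℝ β y) (v w : E) :
    extDeriv β y ![v, w] =
      fderiv ℝ (fun u => β u ![w]) y v - fderiv ℝ (fun u => β u ![v]) y w := by
  rw [extDeriv_apply h, Fin.sum_univ_two]
  have h0 : (0 : Fin 2).removeNth ![v, w] = ![w] := by ext i; fin_cases i; rfl
  have h1 : (1 : Fin 2).removeNth ![v, w] = ![v] := by ext i; fin_cases i; rfl
  simp [h0, h1, sub_eq_add_neg]

theorem wedgeVec_one_form_apply (a b : E [⋀^Fin 1]→L[ℝ] ℝ) (v w : E) :
    wedgeVec a b ![v, w] = a ![v] * b ![w] - a ![w] * b ![v] := by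
  have h0 : (0 : Fin 2).removeNth ![v, w] = ![w] := by ext i; fin_cases i; rfl
  have h1 : (1 : Fin 2).removeNth ![v, w] = ![v] := by ext i; fin_cases i; rfl
  rw [wedgeVec_apply, Fin.sum_univ_two]
  simp [h0, h1, sub_eq_add_neg]

/-- If `θ` agrees with `df` on `v` and `w`, then `e⁻ᶠ (dη - θ ∧ η)(v, w)` is the divergence
`∂_v (e⁻ᶠ η(w)) - ∂_w (e⁻ᶠ η(v))`. -/
theorem exp_mul_extDeriv_sub_wedge {η : E → E [⋀^Fin 1]→L[ℝ] ℝ} {f : E → ℝ} {y : E}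
    (hη : DifferentiableAt ℝ η y) (hf : DifferentiableAt ℝ f y) {θ : E [⋀^Fin 1]→L[ℝ] ℝ} {v w : E}
    (hv : θ ![v] = fderiv ℝ f y v) (hw : θ ![w] = fderiv ℝ f y w) :
    Real.exp (-f y) * (extDeriv η y - wedgeVec θ (η y)) ![v, w] =
      fderiv ℝ (fun u => Real.exp (-f u) * η u ![w]) y v -
        fderiv ℝ (fun u => Real.exp (-f u) * η u ![v]) y w := by
  have hη' (X : E) : DifferentiableAt ℝ (fun u => η u ![X]) y :=
    (ContinuousAlternatingMap.apply ℝ E ℝ ![X]).differentiableAt.comp y hη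
  have key (X Y : E) : fderiv ℝ (fun u => Real.exp (-f u) * η u ![X]) y Y =
      Real.exp (-f y) * (fderiv ℝ (fun u => η u ![X]) y Y - fderiv ℝ f y Y * η y ![X]) := by
    have h := ((hf.hasFDerivAt.fun_neg.exp).fun_mul (hη' X).hasFDerivAt).fderiv
    rw [h]
    simp
    ring
  rw [key, key, ContinuousAlternatingMap.sub_apply, extDeriv_one_form_apply hη,
    wedgeVec_one_form_apply, hv, hw]
  ring

/-- The tangent space of `M` at `x` is identified with `E` by the preferred chart at `x`. -/
theorem hasMFDerivAt_extChartAt_self (x : M) :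
    HasMFDerivAt 𝓘(ℝ, E) 𝓘(ℝ, E) (extChartAt 𝓘(ℝ, E) x) x (ContinuousLinearMap.id ℝ E) := by
  refine ⟨continuousAt_extChartAt x, ?_⟩
  have h : ∀ᶠ u in 𝓝 (extChartAt 𝓘(ℝ, E) x x),
      extChartAt 𝓘(ℝ, E) x ((extChartAt 𝓘(ℝ, E) x).symm u) = id u := by
    filter_upwards [extChartAt_target_mem_nhds x] with u hu
    exact (extChartAt 𝓘(ℝ, E) x).right_inv hu
  exact ((hasFDerivAt_id _).congr_of_eventuallyEq h).hasFDerivWithinAt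

end DForm

/-! ### Differential forms and affine coverings -/

/-- A map `p : E → M` onto a manifold modelled on `E` is an affine covering if it is a quotient map
whose local inverses are the charts of `M`, and if any two points of a fibre are exchanged by an
affine isomorphism of `E` over `M` with linear part in a given set `S`. -/
structure IsAffineCovering {E M : Type} [NormedAddCommGroup E] [NormedSpace ℝ E]
    [TopologicalSpace M] [ChartedSpace E M] (p : E → M) (S : Set (E ≃L[ℝ] E)) : Prop where
  isQuotientMap : Topology.IsQuotientMap p
  extChartAt_symm : ∀ x, ⇑(extChartAt 𝓘(ℝ, E) x).symm = p
  exists_deck : ∀ y z, p y = p z →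
    ∃ A ∈ S, ∃ b : E, (∀ u, p (A u + b) = p u) ∧ A y + b = z

namespace IsAffineCovering

open DForm Topology

variable {E M : Type} [NormedAddCommGroup E] [NormedSpace ℝ E]
  [TopologicalSpace M] [ChartedSpace E M] {p : E → M} {S : Set (E ≃L[ℝ] E)} {k : ℕ}

/-- Near `y`, the chart of `M` at `p y` composed with `p` is a deck transformation. -/
theorem exists_extChartAt_comp_eq (hp : IsAffineCovering p S) (y : E) :
    ∃ A ∈ S, ∃ b : E, (∀ u, p (A u + b) = p u) ∧
      (∀ᶠ u in 𝓝 y, extChartAt 𝓘(ℝ, E) (p y) (p u) = A u + b) := by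
  set e := extChartAt 𝓘(ℝ, E) (p y)
  have hz : p (e (p y)) = p y := by
    have := extChartAt_to_inv (I := 𝓘(ℝ, E)) (p y)
    rwa [hp.extChartAt_symm (p y)] at this
  obtain ⟨A, hAS, b, hA, hy⟩ := hp.exists_deck y (e (p y)) hz.symm
  refine ⟨A, hAS, b, hA, ?_⟩
  have hc : ContinuousAt (fun u => A u + b) y := by fun_prop
  have hT : e.target ∈ 𝓝 (A y + b) := hy ▸ extChartAt_target_mem_nhds (p y)
  filter_upwards [hc.preimage_mem_nhds hT] with u hu
  have := e.right_inv hu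
  rw [hp.extChartAt_symm (p y), hA u] at this
  exact this

/-- In the tangent coordinates of `M` at `p y`, the derivative of `p` is the linear part of a deck
transformation. -/
theorem exists_hasMFDerivAt (hp : IsAffineCovering p S) (y : E) :
    ∃ A ∈ S, ∃ b : E, (∀ u, p (A u + b) = p u) ∧
      extChartAt 𝓘(ℝ, E) (p y) (p y) = A y + b ∧
      HasMFDerivAt 𝓘(ℝ, E) 𝓘(ℝ, E) p y (A : E →L[ℝ] E) := by
  obtain ⟨A, hAS, b, hA, he⟩ := hp.exists_extChartAt_comp_eq y
  refine ⟨A, hAS, b, hA, he.self_of_nhds, hp.isQuotientMap.continuous.continuousAt, ?_⟩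
  have h : HasFDerivAt (fun u => A u + b) (A : E →L[ℝ] E) y :=
    (A : E →L[ℝ] E).hasFDerivAt.add_const b
  exact (h.congr_of_eventuallyEq he).hasFDerivWithinAt

theorem mdifferentiableAt (hp : IsAffineCovering p S) (y : E) :
    MDifferentiableAt 𝓘(ℝ, E) 𝓘(ℝ, E) p y :=
  let ⟨_, _, _, _, _, h⟩ := hp.exists_hasMFDerivAt y
  h.mdifferentiableAt

theorem mfderiv_injective (hp : IsAffineCovering p S) (y : E) :
    Function.Injective (mfderiv 𝓘(ℝ, E) 𝓘(ℝ, E) p y) := by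
  obtain ⟨A, -, b, -, -, h⟩ := hp.exists_hasMFDerivAt y
  rw [h.mfderiv]
  exact A.injective

/-- The pullback to `E` of a differential form on `M`. -/
noncomputable def lift (p : E → M) (α : DForm E M k) (y : E) : E [⋀^Fin k]→L[ℝ] ℝ :=
  (α (p y)).compContinuousLinearMap (mfderiv 𝓘(ℝ, E) 𝓘(ℝ, E) p y : E →L[ℝ] _)

theorem lift_apply (α : DForm E M k) (y : E) (v : Fin k → E) :
    lift p α y v = α (p y) (fun i => mfderiv 𝓘(ℝ, E) 𝓘(ℝ, E) p y (v i)) := rfl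

theorem inChart_eq (hp : IsAffineCovering p S) (x : M) (α : DForm E M k) :
    inChart x α = lift p α := by
  funext y
  unfold inChart lift
  rw [hp.extChartAt_symm x]

/-- The pullback of a form is invariant under deck transformations. -/
theorem lift_deck (hp : IsAffineCovering p S) (α : DForm E M k) {A : E ≃L[ℝ] E} {b : E}
    (hA : ∀ u, p (A u + b) = p u) (y : E) :
    (lift p α (A y + b)).compContinuousLinearMap (A : E →L[ℝ] E) = lift p α y := by
  have hc : p ∘ (fun u => A u + b) = p := funext hA
  have hd : HasFDerivAt (fun u => A u + b) (A : E →L[ℝ] E) y :=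
    (A : E →L[ℝ] E).hasFDerivAt.add_const b
  have hm := mfderiv_comp y (hp.mdifferentiableAt (A y + b)) hd.hasMFDerivAt.mdifferentiableAt
  rw [hd.hasMFDerivAt.mfderiv] at hm
  have h : lift (p ∘ (fun u => A u + b)) α y = lift p α y := by rw [hc]
  rw [← h]
  ext v
  simp only [lift, ContinuousAlternatingMap.compContinuousLinearMap_apply]
  rw [hm]
  rfl

theorem contDiff_lift (hp : IsAffineCovering p S) {α : DForm E M k} (hα : IsSmooth α) :
    ContDiff ℝ ∞ (lift p α) := by
  rw [contDiff_iff_contDiffAt]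
  intro y
  obtain ⟨A, -, b, hA, he, -⟩ := hp.exists_hasMFDerivAt y
  have h1 : ContDiffAt ℝ ∞ (lift p α) (A y + b) := by
    rw [← he, ← hp.inChart_eq (p y) α]
    exact (hα (p y)).contDiffAt (extChartAt_target_mem_nhds (p y))
  have h2 : lift p α = fun u =>
      ContinuousAlternatingMap.compContinuousLinearMapCLM (A : E →L[ℝ] E) (lift p α (A u + b)) :=
    funext fun u => (hp.lift_deck α hA u).symm
  rw [h2]
  exact (ContinuousLinearMap.contDiff _).contDiffAt.comp y
    (ContDiffAt.comp y h1 ((A : E →L[ℝ] E).contDiff.add contDiff_const).contDiffAt)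

theorem isSmooth_of_contDiff_lift (hp : IsAffineCovering p S) {α : DForm E M k}
    (h : ContDiff ℝ ∞ (lift p α)) : IsSmooth α := fun x => by
  rw [hp.inChart_eq x α]
  exact h.contDiffOn

theorem lift_injective (hp : IsAffineCovering p S) :
    Function.Injective (lift p : DForm E M k → _) := by
  intro α β h
  funext x
  obtain ⟨y, rfl⟩ := hp.isQuotientMap.surjective x
  obtain ⟨A, -, b, -, -, hm⟩ := hp.exists_hasMFDerivAt y
  have h' := congrFun h y
  unfold lift at h'
  rw [hm.mfderiv] at h'
  ext v
  have := DFunLike.congr_fun h' (fun i => A.symm (v i))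
  have hv : (A : E →L[ℝ] E) ∘ (fun i => A.symm (v i)) = v :=
    funext fun i => A.apply_symm_apply (v i)
  exact (congrArg (α (p y)) hv.symm).trans (this.trans (congrArg (β (p y)) hv))

/-- The pullback to `E` commutes with exterior derivatives. The chart at `p y` composed with `p` is
a deck transformation near `y`, under which the pullback is invariant. -/
theorem lift_d (hp : IsAffineCovering p S) {α : DForm E M k} (hα : IsSmooth α) :
    lift p (d α) = extDeriv (lift p α) := by
  funext y
  obtain ⟨A, -, b, hA, he, hm⟩ := hp.exists_hasMFDerivAt y
  have hd (u : E) : HasFDerivAt (fun u => A u + b) (A : E →L[ℝ] E) u :=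
    (A : E →L[ℝ] E).hasFDerivAt.add_const b
  have key := extDeriv_pullback (r := ∞) (f := fun u => A u + b) (x := y)
    (show DifferentiableAt ℝ (lift p α) (A y + b) from
      (hp.contDiff_lift hα).differentiable (by simp) _)
    ((A : E →L[ℝ] E).contDiff.add contDiff_const).contDiffAt
    (by simpa using WithTop.coe_le_coe.2 (le_top : (2 : ℕ∞) ≤ ⊤))
  simp only [(hd _).fderiv, hp.lift_deck α hA] at key
  rw [key]
  unfold lift d
  rw [hm.mfderiv, (hasMFDerivAt_extChartAt_self (p y)).mfderiv, hp.inChart_eq, he]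
  rfl

theorem lift_add (α β : DForm E M k) : lift p (α + β) = lift p α + lift p β := rfl

theorem lift_sub (α β : DForm E M k) : lift p (α - β) = lift p α - lift p β := rfl

theorem lift_zero : lift p (0 : DForm E M k) = 0 := rfl

theorem lift_wedge (θ : DForm E M 1) (α : DForm E M k) (y : E) :
    lift p (wedge θ α) y = wedgeVec (lift p θ y) (lift p α y) := by
  ext v
  rw [wedgeVec_apply]
  refine (wedgeVec_apply (E := E) (θ (p y)) (α (p y)) _).trans
    (Finset.sum_congr rfl fun i _ => ?_)
  congr 2
  rw [lift_apply]
  congr 1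
  funext j
  fin_cases j
  rfl

/-- The differential form on `M` which is constant in the preferred coordinates at each point. Its
pullback to `E` is constant if the linear parts of the deck transformations preserve it. -/
def constForm (M : Type) [TopologicalSpace M] [ChartedSpace E M] (c : E [⋀^Fin k]→L[ℝ] ℝ) :
    DForm E M k := fun _ => c

theorem lift_constForm (hp : IsAffineCovering p S) {c : E [⋀^Fin k]→L[ℝ] ℝ}
    (hc : ∀ A ∈ S, c.compContinuousLinearMap (A : E →L[ℝ] E) = c) :
    lift p (constForm M c) = fun _ => c := by
  funext y
  obtain ⟨A, hAS, b, -, -, hm⟩ := hp.exists_hasMFDerivAt y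
  unfold lift
  rw [hm.mfderiv]
  exact hc A hAS

/-- A continuous function on `E` which is constant on the fibres of `p` attains its minimum if `M`
is compact. -/
theorem exists_forall_le [CompactSpace M] [Nonempty E] (hp : IsAffineCovering p S) {f : E → ℝ}
    (hf : Continuous f) (hinv : ∀ y z, p y = p z → f y = f z) : ∃ y, ∀ z, f y ≤ f z := by
  have hs := hp.isQuotientMap.surjective
  have : Nonempty M := ‹Nonempty E›.map p
  let h : M → ℝ := fun x => f (Function.surjInv hs x)
  have hh : h ∘ p = f := funext fun y => hinv _ _ (Function.surjInv_eq hs (p y))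
  have hc : Continuous h := hp.isQuotientMap.continuous_iff.2 (hh ▸ hf)
  obtain ⟨x, -, hx⟩ := isCompact_univ.exists_isMinOn Set.univ_nonempty hc.continuousOn
  refine ⟨Function.surjInv hs x, fun z => ?_⟩
  have h1 : h x ≤ h (p z) := hx (Set.mem_univ (p z))
  rwa [show h (p z) = f z from congrFun hh z] at h1

theorem exists_forall_abs_le [CompactSpace M] [Nonempty E] (hp : IsAffineCovering p S) {f : E → ℝ}
    (hf : Continuous f) (hinv : ∀ y z, p y = p z → f y = f z) : ∃ C, ∀ z, |f z| ≤ C := by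
  obtain ⟨y, hy⟩ := hp.exists_forall_le hf hinv
  obtain ⟨x, hx⟩ := hp.exists_forall_le hf.neg fun y z h => congrArg Neg.neg (hinv y z h)
  exact ⟨max (-f y) (f x), fun z => abs_le.2
    ⟨by linarith [le_max_left (-f y) (f x), hy z],
      (neg_le_neg_iff.1 (hx z)).trans (le_max_right _ _)⟩⟩

theorem lift_zero_form_eq (η : DForm E M 0) {y z : E} (h : p y = p z) :
    lift p η y ![] = lift p η z ![] := by
  have key (u : E) : lift p η u ![] = (fun x => η x ![]) (p u) := by
    rw [lift_apply]
    exact congrArg (η (p u)) (Subsingleton.elim _ _)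
  rw [key, key, h]

/-- On a compact `M`, a form with constant pullback is not the differential of a function unless it
vanishes: the function has a critical point. -/
theorem eq_zero_of_constForm_eq_d [CompactSpace M] [Nonempty E] (hp : IsAffineCovering p S)
    {c : E [⋀^Fin 1]→L[ℝ] ℝ}
    (hc : ∀ A ∈ S, c.compContinuousLinearMap (A : E →L[ℝ] E) = c)
    {η : DForm E M 0} (hη : IsSmooth η) (h : d η = constForm M c) : c = 0 := by
  have hs := hp.contDiff_lift hη
  have h' := (hp.lift_d hη).symm
  rw [h, hp.lift_constForm hc] at h'
  obtain ⟨y, hy⟩ := hp.exists_forall_le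
    ((ContinuousAlternatingMap.apply ℝ E ℝ ![]).continuous.comp hs.continuous)
    fun y z hyz => lift_zero_form_eq η hyz
  have hmin : IsLocalMin (fun u => lift p η u ![]) y := Filter.Eventually.of_forall hy
  ext v
  have hv : v = ![v 0] := by ext i; fin_cases i; rfl
  rw [hv, ← congrFun h' y, extDeriv_zero_form_apply (hs.differentiable (by simp) y),
    hmin.fderiv_eq_zero]
  rfl

end IsAffineCovering

/-! ### Divergences of bounded vector fields on the plane -/

/-- The divergence of a bounded vector field on the plane is not bounded below by a positive
constant: over the square `[0, R]²` its integral is at most of the order of the perimeter. -/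
theorem not_forall_le_divergence {f g : ℝ × ℝ → ℝ} (hf : ContDiff ℝ 1 f) (hg : ContDiff ℝ 1 g)
    {C c : ℝ} (hfC : ∀ x, |f x| ≤ C) (hgC : ∀ x, |g x| ≤ C) (hc : 0 < c) :
    ¬ ∀ x, c ≤ fderiv ℝ f x (1, 0) + fderiv ℝ g x (0, 1) := by
  intro h
  have hdiv : Continuous fun x => fderiv ℝ f x (1, 0) + fderiv ℝ g x (0, 1) :=
    ((hf.continuous_fderiv one_ne_zero).clm_apply continuous_const).add
      ((hg.continuous_fderiv one_ne_zero).clm_apply continuous_const)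
  have hC : 0 ≤ C := (abs_nonneg _).trans (hfC 0)
  -- With this side length, the area term `c R²` exceeds the boundary term `4 C R`.
  set R : ℝ := (4 * C + 1) / c
  have hR : 0 < R := by positivity
  have hcR : c * R = 4 * C + 1 := by simp only [R]; field_simp
  have key := MeasureTheory.integral2_divergence_prod_of_hasFDerivAt f g (fderiv ℝ f) (fderiv ℝ g)
    0 0 R R hf.continuous.continuousOn hg.continuous.continuousOn
    (fun x _ => (hf.differentiable one_ne_zero x).hasFDerivAt)
    (fun x _ => (hg.differentiable one_ne_zero x).hasFDerivAt)
    (hdiv.continuousOn.integrableOn_compact (isCompact_uIcc.prod isCompact_uIcc))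
  have hlow : R * (R * c) ≤
      ∫ x in (0 : ℝ)..R, ∫ y in (0 : ℝ)..R,
        fderiv ℝ f (x, y) (1, 0) + fderiv ℝ g (x, y) (0, 1) := by
    have hin (x : ℝ) : R * c ≤
        ∫ y in (0 : ℝ)..R, fderiv ℝ f (x, y) (1, 0) + fderiv ℝ g (x, y) (0, 1) := by
      have := intervalIntegral.integral_mono_on (μ := MeasureTheory.volume) (a := 0) (b := R)
        hR.le (f := fun _ => c) (by simp)
        ((hdiv.comp (Continuous.prodMk_right x)).intervalIntegrable 0 R) fun y _ => h (x, y)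
      simpa using this
    have := intervalIntegral.integral_mono_on (μ := MeasureTheory.volume) (a := 0) (b := R)
        hR.le (f := fun _ => R * c) (by simp)
        ((intervalIntegral.continuous_parametric_intervalIntegral_of_continuous'
          (f := fun x y => fderiv ℝ f (x, y) (1, 0) + fderiv ℝ g (x, y) (0, 1))
          hdiv 0 R).intervalIntegrable 0 R) fun x _ => hin x
    simpa using this
  have hside (u : ℝ → ℝ) (hu : ∀ x, |u x| ≤ C) : |∫ x in (0 : ℝ)..R, u x| ≤ C * R := by
    have := intervalIntegral.norm_integral_le_of_norm_le_const (a := 0) (b := R) (f := u) (C := C)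
      fun x _ => hu x
    simpa [abs_of_pos hR] using this
  have h1 := abs_le.1 (hside (fun x => g (x, R)) fun x => hgC _)
  have h2 := abs_le.1 (hside (fun x => g (x, 0)) fun x => hgC _)
  have h3 := abs_le.1 (hside (fun y => f (R, y)) fun x => hfC _)
  have h4 := abs_le.1 (hside (fun y => f (0, y)) fun x => hfC _)
  have h5 : R * (R * c) = 4 * (C * R) + R := by
    rw [mul_comm R c, hcR]; ring
  linarith [h1.2, h2.1, h3.2, h4.1]

/-! ### Complex structures and large subspaces -/

/-- A subspace of more than half the dimension contains a complex line of any complex structure. -/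
theorem Submodule.exists_mem_map_mem_of_half_finrank_lt {L : Type} [AddCommGroup L]
    [Module ℝ L] [FiniteDimensional ℝ L] {S : Submodule ℝ L} (hS : (Module.finrank ℝ L : ℝ) / 2 < Module.finrank ℝ S)
    {J : L →ₗ[ℝ] L} (hJ : ∀ X, J (J X) = -X) : ∃ X ∈ S, J X ∈ S ∧ X ≠ 0 := by
  have hinj : Function.Injective J := fun X Y h => by
    have := congrArg J h
    rwa [hJ, hJ, neg_inj] at this
  have h1 : Module.finrank ℝ (S.map J) = Module.finrank ℝ S :=
    (Submodule.equivMapOfInjective J hinj S).finrank_eq.symm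
  have h2 := Submodule.finrank_sup_add_finrank_inf_eq S (S.map J)
  have h3 := Submodule.finrank_le (S ⊔ S.map J)
  have h4 : Module.finrank ℝ L < 2 * Module.finrank ℝ S := by
    have : (Module.finrank ℝ L : ℝ) < 2 * Module.finrank ℝ S := by linarith
    exact_mod_cast this
  have h5 : 0 < Module.finrank ℝ (S ⊓ S.map J : Submodule ℝ L) := by omega
  obtain ⟨Y, hY⟩ := Submodule.exists_mem_ne_zero_of_ne_bot
    (Submodule.one_le_finrank_iff.1 h5)
  obtain ⟨⟨hYS, X, hX, rfl⟩, hne⟩ := hY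
  exact ⟨X, hX, hYS, fun h => hne (by rw [h, map_zero])⟩

/-! ### The groups `ℝ^m ⋉_φ ℝ^n` in coordinates -/

namespace VectorAction

variable {m n : ℕ} (φ : VectorAction m n)

theorem rep_zero (x : Fin n → ℝ) : φ.rep (Multiplicative.ofAdd 0) x = x := by simp

theorem rep_add (a b : Fin m → ℝ) (x : Fin n → ℝ) :
    φ.rep (Multiplicative.ofAdd (a + b)) x =
      φ.rep (Multiplicative.ofAdd a) (φ.rep (Multiplicative.ofAdd b) x) := by
  rw [ofAdd_add, map_mul, Module.End.mul_apply]

/-- The linear part `(b, u) ↦ (b, φ(a) u)` of the left translations by the elements `(a, x)`. -/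
noncomputable def linearPart (a : Fin m → ℝ) : Coord m n ≃L[ℝ] Coord m n :=
  LinearEquiv.toContinuousLinearEquiv <|
    (LinearEquiv.refl ℝ (Fin m → ℝ)).prodCongr <|
      LinearEquiv.ofLinearMap (φ.rep (Multiplicative.ofAdd a)) (φ.rep (Multiplicative.ofAdd (-a)))
        (LinearMap.ext fun x => by
          rw [LinearMap.comp_apply, ← rep_add, add_neg_cancel, rep_zero]; rfl)
        (LinearMap.ext fun x => by
          rw [LinearMap.comp_apply, ← rep_add, neg_add_cancel, rep_zero]; rfl)

theorem linearPart_apply (a : Fin m → ℝ) (X : Coord m n) :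
    φ.linearPart a X = (X.1, φ.rep (Multiplicative.ofAdd a) X.2) := rfl

theorem linearPart_zero (X : Coord m n) : φ.linearPart 0 X = X := by
  rw [linearPart_apply, rep_zero]

theorem linearPart_add (a b : Fin m → ℝ) (X : Coord m n) :
    φ.linearPart (a + b) X = φ.linearPart a (φ.linearPart b X) := by
  simp only [linearPart_apply, rep_add]

theorem contDiff_linearPart (X : Coord m n) :
    ContDiff ℝ ∞ fun a => φ.linearPart a X :=
  contDiff_const.prodMk (φ.smooth.comp (contDiff_id.prodMk contDiff_const))

end VectorAction

namespace MetaAbelianGroup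

open VectorAction

variable {m n : ℕ} {φ : VectorAction m n}

variable (φ) in
/-- The Lie algebra of `ℝ^m ⋉_φ ℝ^n`. -/
abbrev LieAlg : Type := GroupLieAlgebra 𝓘(ℝ, Coord m n) (MetaAbelianGroup φ)

variable (φ) in
/-- The identification of `ℝ^m × ℝ^n` with the Lie algebra, as the tangent space at `(0, 0)`. -/
def lieEquiv : Coord m n ≃ₗ[ℝ] LieAlg φ := LinearEquiv.refl ℝ (Coord m n)

/-- The coordinates of a group element. -/
def coord (g : MetaAbelianGroup φ) : Coord m n := g

variable (φ) in
/-- The group element with given coordinates. -/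
def ofCoord (y : Coord m n) : MetaAbelianGroup φ := y

theorem coord_mul (g h : MetaAbelianGroup φ) :
    coord (g * h) = φ.linearPart (coord g).1 (coord h) + coord g :=
  Prod.ext (add_comm g.1 h.1) (add_comm g.2 _)

/-- The left-invariant vector fields in coordinates. -/
theorem mulInvariantVectorField_lieEquiv (X : Coord m n) (g : MetaAbelianGroup φ) :
    mulInvariantVectorField (lieEquiv φ X) g = φ.linearPart (coord g).1 X := by
  have h : HasFDerivAt (fun h => φ.linearPart (coord g).1 h + coord g)
      (φ.linearPart (coord g).1 : Coord m n →L[ℝ] Coord m n) 0 :=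
    (φ.linearPart (coord g).1 : Coord m n →L[ℝ] Coord m n).hasFDerivAt.add_const _
  have hm : (fun h : MetaAbelianGroup φ => g * h) =
      fun h : MetaAbelianGroup φ => ofCoord φ (φ.linearPart (coord g).1 (coord h) + coord g) :=
    funext (coord_mul g)
  unfold mulInvariantVectorField
  rw [hm]
  exact DFunLike.congr_fun h.hasMFDerivAt.mfderiv X

/-- The bracket of a vector of `ℝ^m` and a vector of `ℝ^n` is the derivative of the action. -/
theorem lieEquiv_symm_bracket (b : Fin m → ℝ) (x : Fin n → ℝ) :
    (lieEquiv φ).symm ⁅lieEquiv φ (b, 0), lieEquiv φ (0, x)⁆ =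
      fderiv ℝ (fun a => φ.linearPart a (0, x)) 0 b := by
  have hV : (mulInvariantVectorField (lieEquiv φ (b, 0)) : (g : MetaAbelianGroup φ) → _) =
      fun _ : Coord m n => ((b, 0) : Coord m n) := by
    funext g
    rw [mulInvariantVectorField_lieEquiv, linearPart_apply, map_zero]
  have hW : (mulInvariantVectorField (lieEquiv φ (0, x)) : (g : MetaAbelianGroup φ) → _) =
      fun y : Coord m n => φ.linearPart y.1 (0, x) := by
    funext g
    rw [mulInvariantVectorField_lieEquiv]
    rfl
  have hd : HasFDerivAt (fun y : Coord m n => φ.linearPart y.1 (0, x))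
      ((fderiv ℝ (fun a => φ.linearPart a (0, x)) 0).comp
        (ContinuousLinearMap.fst ℝ (Fin m → ℝ) (Fin n → ℝ))) 0 :=
    HasFDerivAt.comp (g := fun a => φ.linearPart a (0, x)) (0 : Coord m n)
      ((φ.contDiff_linearPart (0, x)).differentiable (by simp) 0).hasFDerivAt hasFDerivAt_fst
  have key : VectorField.lieBracket ℝ (fun _ : Coord m n => ((b, 0) : Coord m n))
      (fun y => φ.linearPart y.1 (0, x)) 0 = fderiv ℝ (fun a => φ.linearPart a (0, x)) 0 b := by
    rw [VectorField.lieBracket, hd.fderiv]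
    simp
  refine Eq.trans ?_ key
  rw [GroupLieAlgebra.bracket_def, hV, hW]
  have hm := congrFun (VectorField.mlieBracketWithin_eq_lieBracketWithin (𝕜 := ℝ)
    (V := fun _ : Coord m n => ((b, 0) : Coord m n)) (W := fun y => φ.linearPart y.1 (0, x))
    (s := Set.univ)) 0
  rw [VectorField.lieBracketWithin_univ] at hm
  exact hm

/-- A linear form on the Lie algebra which vanishes on all brackets is invariant under the action:
its derivative along `t ↦ φ(t a) x` vanishes. -/
theorem map_linearPart (l : Coord m n →ₗ[ℝ] ℝ)
    (hl : ∀ X Y : LieAlg φ, l ((lieEquiv φ).symm ⁅X, Y⁆) = 0) (a : Fin m → ℝ) (X : Coord m n) :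
    l (φ.linearPart a X) = l X := by
  have h0 (x : Fin n → ℝ) : HasDerivAt (fun s : ℝ => l (φ.linearPart (s • a) (0, x))) 0 0 := by
    have h1 : HasFDerivAt (fun b => φ.linearPart b (0, x))
        (fderiv ℝ (fun b => φ.linearPart b (0, x)) 0) ((0 : ℝ) • a) := by
      rw [zero_smul]
      exact ((φ.contDiff_linearPart (0, x)).differentiable (by simp) 0).hasFDerivAt
    have h2 : HasDerivAt (fun s : ℝ => s • a) a 0 := by
      simpa using (hasDerivAt_id (0 : ℝ)).smul_const a
    have h3 := (LinearMap.toContinuousLinearMap l).hasFDerivAt.comp_hasDerivAt (0 : ℝ)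
      (h1.comp_hasDerivAt (0 : ℝ) h2)
    rw [← lieEquiv_symm_bracket] at h3
    simpa [Function.comp_def, hl] using h3
  have h1 (x : Fin n → ℝ) (t : ℝ) :
      HasDerivAt (fun s : ℝ => l (φ.linearPart (s • a) (0, x))) 0 t := by
    have h2 := HasDerivAt.comp_sub_const t t (by
      rw [sub_self]; exact h0 (φ.rep (Multiplicative.ofAdd (t • a)) x))
    refine h2.congr_of_eventuallyEq (Filter.Eventually.of_forall fun s => ?_)
    have h3 : ((0, φ.rep (Multiplicative.ofAdd (t • a)) x) : Coord m n) =
      φ.linearPart (t • a) (0, x) := rfl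
    simp only [h3]
    rw [← linearPart_add, ← add_smul, sub_add_cancel]
  have h2 (x : Fin n → ℝ) : l (φ.linearPart a (0, x)) = l (0, x) := by
    have := is_const_of_deriv_eq_zero (fun t => (h1 x t).differentiableAt)
      (fun t => (h1 x t).deriv) 1 0
    simpa [linearPart_zero] using this
  have h3 (Y : Coord m n) : Y = (Y.1, 0) + (0, Y.2) := by simp
  rw [h3 X, map_add, map_add, h2, map_add, linearPart_apply, map_zero]

/-- A linear form which vanishes on all brackets is, in coordinates, a homomorphism. -/
theorem map_coord_mul (l : Coord m n →ₗ[ℝ] ℝ)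
    (hl : ∀ X Y : LieAlg φ, l ((lieEquiv φ).symm ⁅X, Y⁆) = 0) (g h : MetaAbelianGroup φ) :
    l (coord (g * h)) = l (coord g) + l (coord h) := by
  rw [coord_mul, map_add, map_linearPart l hl, add_comm]

/-- A continuous linear map which is additive on the group vanishes on the Lie algebra of the
commutator subgroup. -/
theorem map_eq_zero_of_mem_subgroupLieAlgebra_commutator {F : Type} [NormedAddCommGroup F]
    [NormedSpace ℝ F] (l : Coord m n →L[ℝ] F)
    (hl : ∀ g h : MetaAbelianGroup φ, l (coord (g * h)) = l (coord g) + l (coord h))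
    {X : LieAlg φ}
    (hX : X ∈ subgroupLieAlgebra (E := Coord m n) (commutator (MetaAbelianGroup φ))) :
    l ((lieEquiv φ).symm X) = 0 := by
  let f : MetaAbelianGroup φ →* Multiplicative F :=
    MonoidHom.mk' (fun g => Multiplicative.ofAdd (l (coord g))) fun g h => by
      rw [hl, ofAdd_add]
  have hf (g : MetaAbelianGroup φ) (hg : g ∈ commutator (MetaAbelianGroup φ)) :
      l (coord g) = 0 := Abelianization.commutator_subset_ker f hg
  have hle : subgroupLieAlgebra (E := Coord m n) (commutator (MetaAbelianGroup φ)) ≤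
      LinearMap.ker ((l : Coord m n →ₗ[ℝ] F) ∘ₗ (lieEquiv φ).symm.toLinearMap) := by
    refine Submodule.span_le.2 ?_
    rintro X ⟨c, hc, h0, hmem⟩
    have h1 : HasFDerivAt (fun t => coord (c t))
        ((1 : ℝ →L[ℝ] ℝ).smulRight ((lieEquiv φ).symm X)) 0 := by
      have h2 : mulInvariantVectorField (I := 𝓘(ℝ, Coord m n)) X (c 0) =
          (lieEquiv φ).symm X :=
        (mulInvariantVectorField_lieEquiv ((lieEquiv φ).symm X) (c 0)).trans (by
          rw [h0]; exact linearPart_zero φ _)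
      have h3 := hc 0
      rw [h2] at h3
      exact HasMFDerivAt.hasFDerivAt (f := fun t => coord (c t)) h3
    have h2 := (l.hasFDerivAt.comp 0 h1).congr_of_eventuallyEq
      (f₁ := fun _ => (0 : F)) (Filter.Eventually.of_forall fun t => (hf _ (hmem t)).symm)
    have h3 := DFunLike.congr_fun (h2.unique (hasFDerivAt_const 0 0)) 1
    simpa using h3
  exact hle hX

end MetaAbelianGroup

/-! ### Forms on the quotients by lattices -/

namespace MetaAbelianGroup

open VectorAction DForm IsAffineCovering

variable {m n : ℕ} {φ : VectorAction m n} (Γ : Subgroup (MetaAbelianGroup φ))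

/-- The projection to the quotient by `Γ`, as a map on coordinates. -/
def cover (y : Coord m n) : LatticeQuotient Γ := proj Γ (ofCoord φ y)

variable [DiscreteTopology Γ]

theorem isQuotientCoveringMap_proj : IsQuotientCoveringMap (proj Γ) Γ :=
  isQuotientCoveringMap_quotientMk_of_properlyDiscontinuousSMul

variable {Γ} in
theorem exists_deck_of_cover_eq {y z : Coord m n} (h : cover Γ y = cover Γ z) :
    ∃ g : MetaAbelianGroup φ, (∀ u, cover Γ (φ.linearPart (coord g).1 u + coord g) = cover Γ u) ∧
      φ.linearPart (coord g).1 y + coord g = z := by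
  obtain ⟨γ, hγ⟩ := (isQuotientCoveringMap_proj Γ).apply_eq_iff_mem_orbit.1 h.symm
  refine ⟨γ, fun u => ?_, (coord_mul (γ : MetaAbelianGroup φ) (ofCoord φ y)).symm.trans hγ⟩
  have hu := coord_mul (γ : MetaAbelianGroup φ) (ofCoord φ u)
  change cover Γ (φ.linearPart _ (coord (ofCoord φ u)) + _) = _
  rw [← hu]
  exact (isQuotientCoveringMap_proj Γ).map_smul γ (e := ofCoord φ u)

theorem isAffineCovering_cover :
    IsAffineCovering (cover Γ) (Set.range (linearPart φ)) where
  isQuotientMap := (isQuotientCoveringMap_proj Γ).toIsQuotientMap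
  extChartAt_symm x := by
    funext y
    rw [extChartAt_coe_symm]
    change (IsLocalHomeomorph.localInverseAt _ _).symm _ = _
    rw [IsLocalHomeomorph.localInverseAt_symm]
    rfl
  exists_deck y z h :=
    let ⟨g, hg, hz⟩ := exists_deck_of_cover_eq h
    ⟨_, ⟨_, rfl⟩, _, hg, hz⟩

/-- The value of a form on `G/Γ` on left-invariant vector fields is a function on `G/Γ`. -/
theorem lift_invariant {k : ℕ} (α : DForm (Coord m n) (LatticeQuotient Γ) k)
    (X : Fin k → Coord m n) {y z : Coord m n} (h : cover Γ y = cover Γ z) :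
    lift (cover Γ) α y (fun i => φ.linearPart y.1 (X i)) =
      lift (cover Γ) α z (fun i => φ.linearPart z.1 (X i)) := by
  obtain ⟨g, hg, rfl⟩ := exists_deck_of_cover_eq h
  rw [← (isAffineCovering_cover Γ).lift_deck α hg y]
  refine congrArg (lift (cover Γ) α (φ.linearPart (coord g).1 y + coord g)) (funext fun i => ?_)
  change φ.linearPart (coord g).1 (φ.linearPart y.1 (X i)) =
    φ.linearPart (y.1 + (coord g).1) (X i)
  rw [add_comm, linearPart_add]

theorem continuous_lift_invariant {k : ℕ} {α : DForm (Coord m n) (LatticeQuotient Γ) k}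
    (hα : IsSmooth α) (X : Fin k → Coord m n) :
    Continuous fun y => lift (cover Γ) α y (fun i => φ.linearPart y.1 (X i)) := by
  have h1 : Continuous (lift (cover Γ) α) :=
    ((isAffineCovering_cover Γ).contDiff_lift hα).continuous
  have h2 (i : Fin k) : Continuous fun y : Coord m n => φ.linearPart y.1 (X i) :=
    (φ.contDiff_linearPart (X i)).continuous.comp continuous_fst
  have h3 : Continuous fun y : Coord m n => (fun i => φ.linearPart y.1 (X i)) := continuous_pi h2
  exact h1.eval h3

/-- A linear form on the Lie algebra, as a `1`-form with constant coefficients. -/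
noncomputable def constOneForm :
    Module.Dual ℝ (LieAlg φ) →ₗ[ℝ] (Coord m n [⋀^Fin 1]→L[ℝ] ℝ) where
  toFun l := ContinuousAlternatingMap.ofSubsingleton ℝ (Coord m n) ℝ (0 : Fin 1)
    (LinearMap.toContinuousLinearMap (l ∘ₗ (lieEquiv φ).toLinearMap))
  map_add' _ _ := rfl
  map_smul' _ _ := rfl

theorem constOneForm_apply (l : Module.Dual ℝ (LieAlg φ)) (v : Fin 1 → Coord m n) :
    constOneForm l v = l (lieEquiv φ (v 0)) := rfl

theorem constOneForm_linearPart {l : Module.Dual ℝ (LieAlg φ)}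
    (hl : ∀ X Y : LieAlg φ, l ⁅X, Y⁆ = 0) :
    ∀ A ∈ Set.range (linearPart φ), (constOneForm l).compContinuousLinearMap
      (A : Coord m n →L[ℝ] Coord m n) = constOneForm l := by
  rintro _ ⟨a, rfl⟩
  ext v
  exact map_linearPart (l ∘ₗ (lieEquiv φ).toLinearMap) (fun X Y => hl X Y) a (v 0)

theorem wedge_zero_left {k : ℕ} (α : DForm (Coord m n) (LatticeQuotient Γ) k) :
    wedge 0 α = 0 := by
  apply (isAffineCovering_cover Γ).lift_injective
  funext y
  ext v
  rw [lift_wedge, wedgeVec_apply, lift_zero, lift_zero]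
  simp

theorem twistedD_zero_left {k : ℕ} (α : DForm (Coord m n) (LatticeQuotient Γ) k) :
    twistedD 0 α = d α := by
  rw [twistedD, wedge_zero_left, sub_zero]

theorem constForm_mem_closedForms {l : Module.Dual ℝ (LieAlg φ)}
    (hl : ∀ X Y : LieAlg φ, l ⁅X, Y⁆ = 0) :
    constForm (LatticeQuotient Γ) (constOneForm l) ∈ closedForms 0 1 := by
  have hp := isAffineCovering_cover Γ
  have hlift := hp.lift_constForm (constOneForm_linearPart hl)
  have hs : IsSmooth (constForm (LatticeQuotient Γ) (constOneForm l)) :=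
    hp.isSmooth_of_contDiff_lift (by rw [hlift]; exact contDiff_const)
  refine ⟨hs, ?_⟩
  rw [twistedD_zero_left]
  apply hp.lift_injective
  rw [hp.lift_d hs, hlift, lift_zero]
  funext y
  ext v
  rw [extDeriv_apply (differentiableAt_const _)]
  simp

variable (φ) in
/-- The cocycles `H¹(𝔤)`: the linear forms on the Lie algebra which vanish on all brackets. -/
noncomputable abbrev lieCocycles : Submodule ℝ (Module.Dual ℝ (LieAlg φ)) :=
  ⨅ p : LieAlg φ × LieAlg φ, LinearMap.ker (Module.Dual.eval ℝ (LieAlg φ) ⁅p.1, p.2⁆)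

theorem mem_lieCocycles {l : Module.Dual ℝ (LieAlg φ)} :
    l ∈ lieCocycles φ ↔ ∀ X Y : LieAlg φ, l ⁅X, Y⁆ = 0 := by
  simp [lieCocycles, Submodule.mem_iInf]

/-- The map `H¹(𝔤) → H¹(G/Γ)`. -/
noncomputable def lieToDeRham :
    lieCocycles φ →ₗ[ℝ] TwistedCohomology (0 : DForm (Coord m n) (LatticeQuotient Γ) 1) 0 :=
  Submodule.mkQ _ ∘ₗ
    { toFun l := ⟨constForm (LatticeQuotient Γ) (constOneForm l.1),
        constForm_mem_closedForms Γ (mem_lieCocycles.1 l.2)⟩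
      map_add' _ _ := rfl
      map_smul' _ _ := rfl }

theorem lieToDeRham_injective [CompactSpace (LatticeQuotient Γ)] :
    Function.Injective (lieToDeRham Γ) := by
  rw [injective_iff_map_eq_zero]
  intro l h
  obtain ⟨η, hη, h'⟩ := (Submodule.Quotient.mk_eq_zero _).1 h
  rw [twistedD_zero_left] at h'
  have := (isAffineCovering_cover Γ).eq_zero_of_constForm_eq_d
    (constOneForm_linearPart (mem_lieCocycles.1 l.2)) hη h'
  ext X
  exact DFunLike.congr_fun this ![(lieEquiv φ).symm X]

/-- If the first Betti numbers of `G/Γ` and of the Lie algebra agree, a closed `1`-form on `G/Γ` is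
cohomologous to a left-invariant one. -/
theorem exists_eq_constForm_add_d [CompactSpace (LatticeQuotient Γ)]
    (hb : bettiOne (Coord m n) (LatticeQuotient Γ) = lieBettiOne (LieAlg φ))
    {θ : DForm (Coord m n) (LatticeQuotient Γ) 1} (hs : IsSmooth θ) (hθ : d θ = 0) :
    ∃ l : Module.Dual ℝ (LieAlg φ), (∀ X Y : LieAlg φ, l ⁅X, Y⁆ = 0) ∧
      ∃ f : DForm (Coord m n) (LatticeQuotient Γ) 0, IsSmooth f ∧
        θ = constForm (LatticeQuotient Γ) (constOneForm l) + d f := by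
  have : FiniteDimensional ℝ (LieAlg φ) := inferInstanceAs (FiniteDimensional ℝ (Coord m n))
  have hrank : Module.rank ℝ (TwistedCohomology (0 : DForm (Coord m n) (LatticeQuotient Γ) 1) 0) =
      Module.rank ℝ (lieCocycles φ) := hb
  have : FiniteDimensional ℝ (TwistedCohomology (0 : DForm (Coord m n) (LatticeQuotient Γ) 1) 0) :=
    Module.rank_lt_aleph0_iff.1 (hrank ▸ Module.rank_lt_aleph0 ℝ _)
  have hfin : Module.finrank ℝ (lieCocycles φ) = Module.finrank ℝ
      (TwistedCohomology (0 : DForm (Coord m n) (LatticeQuotient Γ) 1) 0) :=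
    congrArg Cardinal.toNat hrank.symm
  have hsurj : Function.Surjective (lieToDeRham Γ) := by
    refine LinearMap.range_eq_top.1 (Submodule.eq_top_of_finrank_eq ?_)
    rw [LinearMap.finrank_range_of_inj (lieToDeRham_injective Γ), hfin]
  have hmem : θ ∈ closedForms 0 1 := ⟨hs, by rw [twistedD_zero_left, hθ]⟩
  obtain ⟨l, hl⟩ := hsurj (Submodule.Quotient.mk ⟨θ, hmem⟩)
  obtain ⟨f, hf, hfe⟩ := (Submodule.Quotient.eq _).1 hl.symm
  rw [twistedD_zero_left] at hfe
  exact ⟨l, mem_lieCocycles.1 l.2, f, hf, by rw [hfe]; exact (add_sub_cancel _ θ).symm⟩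

end MetaAbelianGroup

/-! ### Exact locally conformal symplectic forms -/

namespace MetaAbelianGroup

open VectorAction DForm IsAffineCovering

variable {m n : ℕ} {φ : VectorAction m n} (Γ : Subgroup (MetaAbelianGroup φ)) [DiscreteTopology Γ]

/-- A `2`-form compatible with `J` is positive on the left-invariant vector fields `X` and `J X`. -/
theorem lift_pos_of_isCompatible {α : DForm (Coord m n) (LatticeQuotient Γ) 2}
    {J : (x : LatticeQuotient Γ) → TangentSpace 𝓘(ℝ, Coord m n) x →L[ℝ]
      TangentSpace 𝓘(ℝ, Coord m n) x} (hJ : IsCompatible α J) {J₀ : LieAlg φ →ₗ[ℝ] LieAlg φ}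
    (hJ₀ : ∀ g X, J (proj Γ g) (mfderiv 𝓘(ℝ, Coord m n) 𝓘(ℝ, Coord m n)
        (proj Γ) g (mulInvariantVectorField X g)) =
      mfderiv 𝓘(ℝ, Coord m n) 𝓘(ℝ, Coord m n) (proj Γ) g (mulInvariantVectorField (J₀ X) g))
    {X : Coord m n} (hX : X ≠ 0) (y : Coord m n) :
    0 < lift (cover Γ) α y
      ![φ.linearPart y.1 X, φ.linearPart y.1 ((lieEquiv φ).symm (J₀ (lieEquiv φ X)))] := by
  have h1 := hJ₀ (ofCoord φ y) (lieEquiv φ X)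
  rw [mulInvariantVectorField_lieEquiv X] at h1
  have hY := mulInvariantVectorField_lieEquiv ((lieEquiv φ).symm (J₀ (lieEquiv φ X)))
    (ofCoord φ y)
  rw [LinearEquiv.apply_symm_apply] at hY
  rw [hY] at h1
  have hne : mfderiv 𝓘(ℝ, Coord m n) 𝓘(ℝ, Coord m n) (cover Γ) y (φ.linearPart y.1 X) ≠ 0 := by
    intro h0
    exact hX ((φ.linearPart y.1).map_eq_zero_iff.1
      ((isAffineCovering_cover Γ).mfderiv_injective y
        (h0.trans (ContinuousLinearMap.map_zero _).symm)))
  have h2 := (hJ (cover Γ y) _).2 hne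
  refine h2.trans_eq ?_
  rw [lift_apply]
  refine congrArg (α (cover Γ y)) (funext fun i => ?_)
  fin_cases i
  · rfl
  · exact h1

end MetaAbelianGroup

open MetaAbelianGroup VectorAction DForm IsAffineCovering in
theorem mainTheorem8 {m n : ℕ} (φ : VectorAction m n)
    (hφ : φ.rep.IsSemisimpleRepresentation)
    (hdim : (Module.finrank ℝ
        (GroupLieAlgebra 𝓘(ℝ, Coord m n) (MetaAbelianGroup φ)) : ℝ) / 2 <
      Module.finrank ℝ (subgroupLieAlgebra (E := Coord m n)
        (commutator (MetaAbelianGroup φ))))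
    (Γ : Subgroup (MetaAbelianGroup φ)) [DiscreteTopology Γ]
    [CompactSpace (MetaAbelianGroup.LatticeQuotient Γ)]
    (hb : DForm.bettiOne (Coord m n) (MetaAbelianGroup.LatticeQuotient Γ) =
      lieBettiOne (GroupLieAlgebra 𝓘(ℝ, Coord m n) (MetaAbelianGroup φ)))
    (α : DForm (Coord m n) (MetaAbelianGroup.LatticeQuotient Γ) 2)
    (θ : DForm (Coord m n) (MetaAbelianGroup.LatticeQuotient Γ) 1)
    (hα : DForm.IsLCS α θ)
    (hJ : ∃ J, MetaAbelianGroup.IsLeftInvariantAlmostComplex Γ J ∧ DForm.IsCompatible α J) :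
    DForm.twistedClass θ α hα.mem_closedForms ≠ 0 := by
  intro h0
  obtain ⟨η, hη, hηα : twistedD θ η = α⟩ := (Submodule.Quotient.mk_eq_zero _).1 h0
  obtain ⟨J, ⟨J₀, hJ₀, hJ₁⟩, hJα⟩ := hJ
  obtain ⟨l, hl, f, hf, hθ⟩ := exists_eq_constForm_add_d Γ hb hα.lee_smooth hα.lee_closed
  have hp := isAffineCovering_cover Γ
  have : FiniteDimensional ℝ (LieAlg φ) := inferInstanceAs (FiniteDimensional ℝ (Coord m n))
  obtain ⟨X, hXS, hJXS, hX0⟩ := Submodule.exists_mem_map_mem_of_half_finrank_lt hdim hJ₀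
  set v : Coord m n := (lieEquiv φ).symm X
  set w : Coord m n := (lieEquiv φ).symm (J₀ X)
  have hv0 : v ≠ 0 := fun h => hX0 ((lieEquiv φ).symm.map_eq_zero_iff.1 h)
  have hfst {Y : LieAlg φ} (hY : Y ∈ subgroupLieAlgebra (E := Coord m n)
      (commutator (MetaAbelianGroup φ))) : ((lieEquiv φ).symm Y).1 = 0 :=
    map_eq_zero_of_mem_subgroupLieAlgebra_commutator
      (ContinuousLinearMap.fst ℝ (Fin m → ℝ) (Fin n → ℝ)) (fun _ _ => rfl) hY
  have hlY {Y : LieAlg φ} (hY : Y ∈ subgroupLieAlgebra (E := Coord m n)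
      (commutator (MetaAbelianGroup φ))) : l Y = 0 :=
    map_eq_zero_of_mem_subgroupLieAlgebra_commutator
      (LinearMap.toContinuousLinearMap (l ∘ₗ (lieEquiv φ).toLinearMap))
      (map_coord_mul (l ∘ₗ (lieEquiv φ).toLinearMap) hl) hY
  -- The function `f` and, below, `P Y = e⁻ᶠ η(Y)` for a constant vector `Y`, on the cover.
  let F : Coord m n → ℝ := fun y => lift (cover Γ) f y ![]
  have hFs : ContDiff ℝ ∞ F :=
    (ContinuousAlternatingMap.apply ℝ (Coord m n) ℝ ![]).contDiff.comp (hp.contDiff_lift hf)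
  have hFi {y z : Coord m n} (h : cover Γ y = cover Γ z) : F y = F z := lift_zero_form_eq f h
  have hηs := hp.contDiff_lift hη
  let P (Y y : Coord m n) : ℝ := Real.exp (-F y) * lift (cover Γ) η y ![Y]
  have hPs (Y : Coord m n) : ContDiff ℝ ∞ (P Y) := hFs.neg.exp.mul
    ((ContinuousAlternatingMap.apply ℝ (Coord m n) ℝ ![Y]).contDiff.comp hηs)
  -- Over `{0} × ℝ^n` the constant field `Y` is left-invariant, so `P Y` is there the restriction of
  -- a function which descends to the compact quotient.
  have hPb (Y : Coord m n) : ∃ C, ∀ y : Coord m n, y.1 = 0 → |P Y y| ≤ C := by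
    obtain ⟨C, hC⟩ := hp.exists_forall_abs_le
      (f := fun y => Real.exp (-F y) * lift (cover Γ) η y fun _ => φ.linearPart y.1 Y)
      (hFs.continuous.neg.rexp.mul (continuous_lift_invariant Γ hη fun _ => Y))
      fun y z h => by
        rw [hFi h, lift_invariant Γ η (fun _ => Y) h]
    refine ⟨C, fun y hy => ?_⟩
    have := hC y
    simp only [hy, linearPart_zero] at this
    have hvec : (fun _ : Fin 1 => Y) = ![Y] := funext fun i => by fin_cases i; rfl
    rwa [hvec] at this
  obtain ⟨c, hc, hcα⟩ : ∃ c > 0, ∀ y : Coord m n, y.1 = 0 →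
      c ≤ Real.exp (-F y) * lift (cover Γ) α y ![v, w] := by
    have hvec (y : Coord m n) : (fun i => φ.linearPart y.1 (![v, w] i)) =
        ![φ.linearPart y.1 v, φ.linearPart y.1 w] := by
      ext1 i; fin_cases i <;> rfl
    obtain ⟨x, hx⟩ := hp.exists_forall_le
      (f := fun y => Real.exp (-F y) * lift (cover Γ) α y fun i => φ.linearPart y.1 (![v, w] i))
      (hFs.continuous.neg.rexp.mul (continuous_lift_invariant Γ hα.smooth ![v, w]))
      fun y z h => by
        rw [hFi h, lift_invariant Γ α ![v, w] h]
    refine ⟨_, ?_, fun y hy => (hx y).trans_eq ?_⟩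
    · simp only [hvec]
      exact mul_pos (Real.exp_pos _) (lift_pos_of_isCompatible Γ hJα hJ₁ hv0 x)
    · simp only [hy, linearPart_zero]
  have hθY {Y : LieAlg φ} (hY : Y ∈ subgroupLieAlgebra (E := Coord m n)
      (commutator (MetaAbelianGroup φ))) (y : Coord m n) :
      lift (cover Γ) θ y ![(lieEquiv φ).symm Y] = fderiv ℝ F y ((lieEquiv φ).symm Y) := by
    rw [hθ, lift_add, hp.lift_constForm (constOneForm_linearPart hl), hp.lift_d hf]
    change constOneForm l _ + extDeriv (lift (cover Γ) f) y ![_] = _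
    rw [constOneForm_apply, extDeriv_zero_form_apply
      ((hp.contDiff_lift hf).differentiable (by simp) y)]
    change l Y + _ = _
    rw [hlY hY, zero_add]
  have hdiv (y : Coord m n) : Real.exp (-F y) * lift (cover Γ) α y ![v, w] =
      fderiv ℝ (P w) y v - fderiv ℝ (P v) y w := by
    rw [← exp_mul_extDeriv_sub_wedge (hηs.differentiable (by simp) y)
      (hFs.differentiable (by simp) y) (hθY hXS y) (hθY hJXS y), ← hηα, twistedD, lift_sub,
      hp.lift_d hη]
    change _ * (_ - lift (cover Γ) (wedge θ η) y) _ = _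
    rw [lift_wedge]
  -- Restrict to the orbit of the plane spanned by `v` and `w` through the identity.
  let T : ℝ × ℝ →L[ℝ] Coord m n :=
    (ContinuousLinearMap.fst ℝ ℝ ℝ).smulRight v + (ContinuousLinearMap.snd ℝ ℝ ℝ).smulRight w
  have hT (x : ℝ × ℝ) : (T x).1 = 0 := by
    have h1 : v.1 = 0 := hfst hXS
    have h2 : w.1 = 0 := hfst hJXS
    simp [T, h1, h2]
  have hfd (Y : Coord m n) (x u : ℝ × ℝ) :
      fderiv ℝ (fun x => P Y (T x)) x u = fderiv ℝ (P Y) (T x) (T u) := by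
    have h := (((hPs Y).differentiable (by simp) (T x)).hasFDerivAt.comp x T.hasFDerivAt).fderiv
    exact DFunLike.congr_fun h u
  obtain ⟨C₁, hC₁⟩ := hPb w
  obtain ⟨C₂, hC₂⟩ := hPb v
  have hPT (Y : Coord m n) : ContDiff ℝ 1 fun x => P Y (T x) :=
    ((hPs Y).comp T.contDiff).of_le (by simp)
  refine not_forall_le_divergence (hPT w) (hPT v).neg (C := max C₁ C₂)
    (fun x => (hC₁ _ (hT x)).trans (le_max_left _ _))
    (fun x => by rw [abs_neg]; exact (hC₂ _ (hT x)).trans (le_max_right _ _)) hc fun x => ?_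
  rw [fderiv_fun_neg, neg_apply, hfd, hfd, ← sub_eq_add_neg]
  have h1 : T (1, 0) = v := by simp [T]
  have h2 : T (0, 1) = w := by simp [T]
  rw [h1, h2, ← hdiv]
  exact hcα _ (hT x)
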